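/- Let $n,m\ge 1$ be integers. Let $\Omega\subset\mathbb R^n$ be a nonempty, bounded, connected open set with Lipschitz boundary, and let $D\subset\Omega$ be measurable with $|\Omega\setminus D|>0$. Let $p\in(1,\infty)$, $s\in(0,1)$, $l\in\{0,1\}$, $\alpha>0$, $z\ge 0$. Let $\rho\in C_c^\infty(\mathbb R^n;\mathbb R)$ be non-negative and radially symmetric with $\int_{\mathbb R^n}\rho\,dx=1$, and suppose that $\{x:\rho(x)\ge\tau\}=\{x:|x|\le\eta\}$ for some $0<\tau<\|\rho\|_{L^\infty}$ and some $\eta>0$. Let $\|\cdot\|_F$ be the Frobenius norm on $\mathbb R^{m\times m}$ and, for a symmetric positive definite matrix $A$ with eigenvalues $\mu_1,\dots,\mu_m$ and orthogonal eigendecomposition $A=V\,\mathrm{diag}(\mu_1,\dots,\mu_m)V^T$, let $\mathrm{Log}(A)=V\,\mathrm{diag}(\log\mu_1,\dots,\log\mu_m)V^T$. Let $\mathrm{SPD}^{\mathrm{Log}}_z$ be the set of symmetric positive definite $A\in\mathbb R^{m\times m}$ with $\|\mathrm{Log}(A)\|_F\le z$, and equip it with the log-Euclidean metric $d(A,B)=\|\mathrm{Log}(A)-\mathrm{Log}(B)\|_F$.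 For $K\subset\mathbb R^{m\times m}$ let $L^p(\Omega;K)$ be the set of $w\in L^p(\Omega;\mathbb R^{m\times m})$ with $w(x)\in K$ for a.e. $x\in\Omega$, and let $W^{s,p}(\Omega;K)$ be the set of those $w\in L^p(\Omega;K)$ for which $(x,y)\mapsto \|w(x)-w(y)\|_F/|x-y|^{n/p+s}$ belongs to $L^p(\Omega\times\Omega)$; functions that agree almost everywhere are identified. Let $w^\delta\in L^p(\Omega;\mathrm{SPD}^{\mathrm{Log}}_z)$ and define $$\mathcal F(w)=\int_{\Omega}\chi_{\Omega\setminus D}(x)\,d^p\big(w(x),w^\delta(x)\big)\,dx+\alpha\int_{\Omega\times\Omega}\frac{d^p\big(w(x),w(y)\big)}{|x-y|^{n+ps}}\,\rho^l(x-y)\,d(x,y).$$ Then $\mathcal F$ has exactly one minimizer over $W^{s,p}(\Omega;\mathrm{SPD}^{\mathrm{Log}}_z)$. -/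

import Mathlib

open MeasureTheory
open scoped ENNReal NNReal ContDiff

/- Matrices carry the Frobenius norm throughout. -/
attribute [local instance] Matrix.frobeniusNormedAddCommGroup

noncomputable section

/-- The Euclidean space `ℝⁿ`. -/
abbrev Rn (n : ℕ) : Type := EuclideanSpace ℝ (Fin n)

/-- Real `m × m` matrices. -/
abbrev Mat (m : ℕ) : Type := Matrix (Fin m) (Fin m) ℝ

/-- Every boundary point of `Ω` has a ball in which, for some unit vector `e`, the set `Ω` is the
region strictly above the graph, in direction `e`, of a Lipschitz function of the component
orthogonal to `e`. -/
def HasLipschitzBoundary {n : ℕ} (Ω : Set (Rn n)) : Prop :=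
  ∀ x ∈ frontier Ω, ∃ r : ℝ, 0 < r ∧ ∃ e : Rn n, ‖e‖ = 1 ∧
    ∃ (L : ℝ≥0) (g : Rn n → ℝ), LipschitzWith L g ∧
      ∀ y ∈ Metric.ball x r, (y ∈ Ω ↔ g (y - inner ℝ e y • e) < inner ℝ e y)

/-- Mollifiers: smooth, compactly supported, non-negative, radially symmetric functions of
integral one that have a superlevel set, at a positive level below the supremum norm, which is a
closed ball of positive radius around the origin. -/
structure IsMollifier {n : ℕ} (ρ : Rn n → ℝ) : Prop where
  contDiff : ContDiff ℝ ∞ ρ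
  hasCompactSupport : HasCompactSupport ρ
  nonneg : ∀ x, 0 ≤ ρ x
  radial : ∀ x y, ‖x‖ = ‖y‖ → ρ x = ρ y
  integral_eq_one : ∫ x, ρ x = 1
  superlevel : ∃ τ : ℝ, 0 < τ ∧ ENNReal.ofReal τ < eLpNorm ρ ∞ volume ∧
    ∃ η : ℝ, 0 < η ∧ {x | τ ≤ ρ x} = Metric.closedBall 0 η

/-- The matrix logarithm of a symmetric positive definite matrix: the scalar logarithm applied to
the eigenvalues in an orthogonal eigendecomposition. -/
def matLog {m : ℕ} (A : Mat m) : Mat m := cfc Real.log A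

/-- The log-Euclidean distance `‖Log A - Log B‖_F`. -/
def logDist {m : ℕ} (A B : Mat m) : ℝ := ‖matLog A - matLog B‖

/-- Symmetric positive definite matrices whose logarithm has Frobenius norm at most `z`. -/
def SPDLog (m : ℕ) (z : ℝ) : Set (Mat m) := {A | A.PosDef ∧ ‖matLog A‖ ≤ z}

/-- The space `L^p(Ω; ℝ^{m × m})` of equivalence classes of functions. -/
abbrev LpMat {n : ℕ} (m : ℕ) (Ω : Set (Rn n)) (p : ℝ) : Type :=
  Lp (Mat m) (ENNReal.ofReal p) (volume.restrict Ω)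

/-- The Lebesgue set `L^p(Ω; K)`. -/
def lebesgueSet {n m : ℕ} (Ω : Set (Rn n)) (p : ℝ) (K : Set (Mat m)) : Set (LpMat m Ω p) :=
  {w | ∀ᵐ x ∂(volume.restrict Ω), w x ∈ K}

/-- The fractional Sobolev space `W^{s,p}(Ω; ℝ^{m × m})`, as a subset of `L^p`. -/
def fracSobolev {n : ℕ} (m : ℕ) (Ω : Set (Rn n)) (s p : ℝ) : Set (LpMat m Ω p) :=
  {w | MemLp (fun q : Rn n × Rn n => ‖w q.1 - w q.2‖ / ‖q.1 - q.2‖ ^ ((n : ℝ) / p + s))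
    (ENNReal.ofReal p) ((volume.restrict Ω).prod (volume.restrict Ω))}

/-- The fractional Sobolev set `W^{s,p}(Ω; K)`. -/
def fracSobolevSet {n m : ℕ} (Ω : Set (Rn n)) (s p : ℝ) (K : Set (Mat m)) :
    Set (LpMat m Ω p) :=
  {w | w ∈ fracSobolev m Ω s p ∧ ∀ᵐ x ∂(volume.restrict Ω), w x ∈ K}

/-- The regularizer
`Φ(w) = ∫_{Ω × Ω} d(w(x), w(y))^p / |x - y|^{n + p s} * ρ(x - y)^l d(x,y)`, with values in
`[0, ∞]`. -/
def regularizer {n m : ℕ} (Ω : Set (Rn n)) (s p : ℝ) (ρ : Rn n → ℝ) (l : ℕ)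
    (w : Rn n → Mat m) : ℝ≥0∞ :=
  ∫⁻ q : Rn n × Rn n,
    ENNReal.ofReal
      (logDist (w q.1) (w q.2) ^ p / ‖q.1 - q.2‖ ^ ((n : ℝ) + p * s) * ρ (q.1 - q.2) ^ l)
    ∂((volume.restrict Ω).prod (volume.restrict Ω))

/-- The functional
`F(w) = ∫_Ω χ_{Ω \ D}(x) d(w(x), v(x))^p dx + α Φ(w)`, with values in `[0, ∞]`. -/
def functionalF {n m : ℕ} (Ω D : Set (Rn n)) (s p α : ℝ) (ρ : Rn n → ℝ) (l : ℕ)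
    (v w : Rn n → Mat m) : ℝ≥0∞ :=
  (∫⁻ x in Ω, (Ω \ D).indicator (fun x => ENNReal.ofReal (logDist (w x) (v x) ^ p)) x)
    + ENNReal.ofReal α * regularizer Ω s p ρ l w

end

/-! The map `matLog` carries `SPDLog m z` onto `symBall m z`, a compact convex set of symmetric
matrices, and turns the log-Euclidean metric into the Frobenius norm. In the coordinate `u = Log w`
the functional is therefore a `pairEnergy`: a fidelity term on `Ω \ D` plus a weighted double
integral of increments, both convex for `p > 1` (`functionalF_eq_pairEnergy`).

Existence is the direct method over all measurable `u` with values in `symBall m z`. These form a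
bounded set in the Hilbert space `L²`, where sublevel sets of the energy are convex, and closed by
Fatou (`exists_pairEnergy_minimal`). No Sobolev bound is imposed: finite energy controls close
pairs, boundedness controls distant ones, and the exponential is Lipschitz on the ball
(`memLp_gagliardo`).

Uniqueness comes from strict convexity of the `p`-th power of the norm. Two minimizers `u`, `v`
agree a.e. on `Ω \ D` and have equal increments wherever the kernel is positive, in particular for
distinct points closer than `η`. Thus `u - v` is locally constant a.e. and vanishes on a set of
positive measure, so connectedness of `Ω` forces `u = v` (`ae_eq_zero_of_locally_const`). -/

section Convexity

/-- The `p`-th power of a strictly convex norm is strictly convex for `p > 1`. -/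
theorem strictConvexOn_norm_rpow {E : Type*} [NormedAddCommGroup E] [NormedSpace ℝ E]
    [StrictConvexSpace ℝ E] {p : ℝ} (hp : 1 < p) :
    StrictConvexOn ℝ Set.univ (fun x : E => ‖x‖ ^ p) := by
  refine ⟨convex_univ, fun x _ y _ hxy a b ha hb hab => ?_⟩
  have hp0 : 0 < p := by linarith
  simp only [smul_eq_mul]
  by_cases h : ‖x‖ = ‖y‖
  · have h1 : ‖a • x + b • y‖ < ‖y‖ :=
      norm_combo_lt_of_ne h.le le_rfl hxy ha hb hab
    have h2 := Real.rpow_lt_rpow (norm_nonneg _) h1 hp0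
    rw [h, ← add_mul, hab, one_mul]
    exact h2
  · have h1 : ‖a • x + b • y‖ ≤ a * ‖x‖ + b * ‖y‖ := by
      refine (norm_add_le _ _).trans_eq ?_
      rw [norm_smul, norm_smul, Real.norm_of_nonneg ha.le, Real.norm_of_nonneg hb.le]
    exact (Real.rpow_le_rpow (norm_nonneg _) h1 hp0.le).trans_lt
      ((strictConvexOn_rpow hp).2 (norm_nonneg x) (norm_nonneg y) h ha hb hab)

variable {E : Type*} [NormedAddCommGroup E]

theorem enorm_rpow_eq_ofReal (x : E) {p : ℝ} (hp : 0 ≤ p) :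
    ‖x‖ₑ ^ p = ENNReal.ofReal (‖x‖ ^ p) := by
  rw [← ofReal_norm, ENNReal.ofReal_rpow_of_nonneg (norm_nonneg _) hp]

variable [NormedSpace ℝ E] [StrictConvexSpace ℝ E]

theorem enorm_combo_rpow_le {p : ℝ} (hp : 1 < p) (x y : E) {a b : ℝ} (ha : 0 ≤ a) (hb : 0 ≤ b)
    (hab : a + b = 1) :
    ‖a • x + b • y‖ₑ ^ p ≤ ENNReal.ofReal a * ‖x‖ₑ ^ p + ENNReal.ofReal b * ‖y‖ₑ ^ p := by
  have hp0 : 0 ≤ p := by linarith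
  simp only [enorm_rpow_eq_ofReal _ hp0]
  rw [← ENNReal.ofReal_mul ha, ← ENNReal.ofReal_mul hb,
    ← ENNReal.ofReal_add (by positivity) (by positivity)]
  exact ENNReal.ofReal_le_ofReal
    ((strictConvexOn_norm_rpow hp).convexOn.2 (Set.mem_univ x) (Set.mem_univ y) ha hb hab)

theorem eq_of_enorm_combo_rpow_eq {p : ℝ} (hp : 1 < p) {x y : E} {a b : ℝ} (ha : 0 < a)
    (hb : 0 < b) (hab : a + b = 1)
    (h : ‖a • x + b • y‖ₑ ^ p = ENNReal.ofReal a * ‖x‖ₑ ^ p + ENNReal.ofReal b * ‖y‖ₑ ^ p) :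
    x = y := by
  have hp0 : 0 ≤ p := by linarith
  by_contra hxy
  simp only [enorm_rpow_eq_ofReal _ hp0] at h
  rw [← ENNReal.ofReal_mul ha.le, ← ENNReal.ofReal_mul hb.le,
    ← ENNReal.ofReal_add (by positivity) (by positivity),
    ENNReal.ofReal_eq_ofReal_iff (by positivity) (by positivity)] at h
  exact ((strictConvexOn_norm_rpow hp).2 (Set.mem_univ x) (Set.mem_univ y) hxy ha hb hab).ne h

end Convexity

/-! ### Semicontinuity and strict convexity of weighted `p`-energies -/

section WeightedEnergy

/-- The weighted `p`-energy `∫ ‖U‖ ^ p k dν`. -/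
noncomputable def weightedEnergy {Y E : Type*} [MeasurableSpace Y] [NormedAddCommGroup E]
    (ν : Measure Y) (p : ℝ) (k : Y → ℝ≥0∞) (U : Y → E) : ℝ≥0∞ :=
  ∫⁻ y, ‖U y‖ₑ ^ p * k y ∂ν

variable {Y E : Type*} [MeasurableSpace Y] {ν : Measure Y} {p : ℝ} {k : Y → ℝ≥0∞}
  [NormedAddCommGroup E]

theorem aemeasurable_weightedEnergy_integrand (hk : AEMeasurable k ν) {U : Y → E}
    (hU : AEStronglyMeasurable U ν) : AEMeasurable (fun y => ‖U y‖ₑ ^ p * k y) ν :=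
  (hU.enorm.pow_const p).mul hk

/-- The weighted energy is lower semicontinuous under almost everywhere convergence. -/
theorem weightedEnergy_le_liminf (hk : AEMeasurable k ν) (hkt : ∀ y, k y ≠ ⊤)
    {U : ℕ → Y → E} {V : Y → E} (hU : ∀ j, AEStronglyMeasurable (U j) ν)
    (hlim : ∀ᵐ y ∂ν, Filter.Tendsto (fun j => U j y) Filter.atTop (nhds (V y))) :
    weightedEnergy ν p k V ≤ Filter.liminf (fun j => weightedEnergy ν p k (U j)) Filter.atTop := by
  refine le_trans (lintegral_mono_ae ?_)
    (lintegral_liminf_le' fun j => aemeasurable_weightedEnergy_integrand hk (hU j))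
  filter_upwards [hlim] with y hy
  refine le_of_eq (Filter.Tendsto.liminf_eq ?_).symm
  exact ENNReal.Tendsto.mul_const
    ((ENNReal.continuous_rpow_const.tendsto _).comp hy.enorm) (Or.inr (hkt y))

theorem lintegral_combo_weightedEnergy (hk : AEMeasurable k ν) {U V : Y → E}
    (hU : AEStronglyMeasurable U ν) (hV : AEStronglyMeasurable V ν) (a b : ℝ) :
    ∫⁻ y, (ENNReal.ofReal a * ‖U y‖ₑ ^ p + ENNReal.ofReal b * ‖V y‖ₑ ^ p) * k y ∂ν =
      ENNReal.ofReal a * weightedEnergy ν p k U + ENNReal.ofReal b * weightedEnergy ν p k V := by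
  have hU' := aemeasurable_weightedEnergy_integrand (p := p) hk hU
  have hV' := aemeasurable_weightedEnergy_integrand (p := p) hk hV
  simp only [add_mul, mul_assoc]
  rw [lintegral_add_left' (hU'.const_mul _), lintegral_const_mul'' _ hU',
    lintegral_const_mul'' _ hV']
  rfl

variable [NormedSpace ℝ E] [StrictConvexSpace ℝ E]

theorem weightedEnergy_combo_le (hp : 1 < p) (hk : AEMeasurable k ν) {U V : Y → E}
    (hU : AEStronglyMeasurable U ν) (hV : AEStronglyMeasurable V ν) {a b : ℝ} (ha : 0 ≤ a)
    (hb : 0 ≤ b) (hab : a + b = 1) :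
    weightedEnergy ν p k (fun y => a • U y + b • V y) ≤
      ENNReal.ofReal a * weightedEnergy ν p k U + ENNReal.ofReal b * weightedEnergy ν p k V := by
  rw [← lintegral_combo_weightedEnergy hk hU hV]
  refine lintegral_mono fun y => ?_
  dsimp only
  gcongr
  exact enorm_combo_rpow_le hp _ _ ha hb hab

/-- Equality in the convexity inequality forces equality wherever the weight is positive. -/
theorem ae_eq_of_weightedEnergy_combo_ge (hp : 1 < p) (hk : AEMeasurable k ν)
    (hkt : ∀ y, k y ≠ ⊤) {U V : Y → E}
    (hU : AEStronglyMeasurable U ν) (hV : AEStronglyMeasurable V ν) {a b : ℝ} (ha : 0 < a)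
    (hb : 0 < b) (hab : a + b = 1)
    (hfin : weightedEnergy ν p k (fun y => a • U y + b • V y) ≠ ⊤)
    (h : ENNReal.ofReal a * weightedEnergy ν p k U + ENNReal.ofReal b * weightedEnergy ν p k V ≤
      weightedEnergy ν p k (fun y => a • U y + b • V y)) :
    ∀ᵐ y ∂ν, k y ≠ 0 → U y = V y := by
  rw [← lintegral_combo_weightedEnergy hk hU hV] at h
  have hle : ∀ y, ‖a • U y + b • V y‖ₑ ^ p * k y ≤
      (ENNReal.ofReal a * ‖U y‖ₑ ^ p + ENNReal.ofReal b * ‖V y‖ₑ ^ p) * k y := fun y => by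
    gcongr
    exact enorm_combo_rpow_le hp _ _ ha.le hb.le hab
  have hm : AEMeasurable (fun y => (ENNReal.ofReal a * ‖U y‖ₑ ^ p +
      ENNReal.ofReal b * ‖V y‖ₑ ^ p) * k y) ν :=
    (((hU.enorm.pow_const p).const_mul _).add ((hV.enorm.pow_const p).const_mul _)).mul hk
  filter_upwards [ae_eq_of_ae_le_of_lintegral_le (Filter.Eventually.of_forall hle) hfin hm h]
    with y hy hky
  exact eq_of_enorm_combo_rpow_eq hp ha hb hab
    ((ENNReal.mul_left_inj hky (hkt y)).1 hy)

end WeightedEnergy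

/-! ### Minimization in a Hilbert space without weak topologies -/

section DirectMethod

/-- A function on a bounded subset of a Hilbert space whose sublevel sets are closed and convex
attains its minimum. -/
theorem exists_isMinOn_of_isClosed_convex_sublevel {H : Type*} [NormedAddCommGroup H]
    [InnerProductSpace ℝ H] [CompleteSpace H] {S : Set H} {G : H → ℝ≥0∞} (hne : S.Nonempty)
    (hb : Bornology.IsBounded S) (hconv : ∀ c, Convex ℝ {u | u ∈ S ∧ G u ≤ c})
    (hcl : ∀ c, IsClosed {u | u ∈ S ∧ G u ≤ c}) : ∃ u ∈ S, IsMinOn G S u := by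
  obtain ⟨c, hc_anti, hc_lim, hc_mem⟩ :=
    exists_seq_tendsto_sInf (hne.image G) (OrderBot.bddBelow _)
  set C : ℕ → Set H := fun j => {u | u ∈ S ∧ G u ≤ c j} with hC
  have hCne : ∀ j, (C j).Nonempty := fun j => by
    obtain ⟨u, hu, hGu⟩ := hc_mem j
    exact ⟨u, hu, hGu.le⟩
  have hCanti : ∀ {i j}, i ≤ j → C j ⊆ C i := fun hij u hu => ⟨hu.1, hu.2.trans (hc_anti hij)⟩
  -- The projection of the origin onto each sublevel set gives a minimizing sequence that converges
  -- strongly, which replaces weak compactness.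
  have hproj : ∀ j, ∃ v ∈ C j, ∀ w ∈ C j, ‖v‖ ≤ ‖w‖ := fun j => by
    obtain ⟨v, hv, hvmin⟩ := exists_norm_eq_iInf_of_complete_convex (hCne j)
      (hcl (c j)).isComplete (hconv (c j)) 0
    refine ⟨v, hv, fun w hw => ?_⟩
    have h1 : ⨅ w : C j, ‖(0 : H) - w‖ ≤ ‖(0 : H) - w‖ :=
      ciInf_le ⟨0, by rintro _ ⟨w, rfl⟩; exact norm_nonneg _⟩ (⟨w, hw⟩ : C j)
    simpa using hvmin.le.trans h1
  choose v hvC hvmin using hproj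
  obtain ⟨R, hR⟩ := hb.exists_norm_le
  have hmono : Monotone fun j => ‖v j‖ ^ 2 := fun i j hij => by
    have := hvmin i (v j) (hCanti hij (hvC j))
    dsimp only
    gcongr
  have hbdd : BddAbove (Set.range fun j => ‖v j‖ ^ 2) := by
    refine ⟨R ^ 2, ?_⟩
    rintro _ ⟨j, rfl⟩
    have := hR (v j) (hvC j).1
    dsimp only
    gcongr
  have hcau := (tendsto_atTop_ciSup hmono hbdd).cauchySeq
  -- The midpoint stays in the convex set `C i`, so its norm is at least `‖v i‖`; the parallelogram
  -- law turns this into a bound on the distance.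
  have hsq : ∀ i j, i ≤ j → ‖v j - v i‖ ^ 2 ≤ 2 * (‖v j‖ ^ 2 - ‖v i‖ ^ 2) := fun i j hij => by
    have hmid : (1 / 2 : ℝ) • v i + (1 / 2 : ℝ) • v j ∈ C i :=
      hconv (c i) (hvC i) (hCanti hij (hvC j)) (by norm_num) (by norm_num) (by norm_num)
    have h1 := hvmin i _ hmid
    rw [← smul_add, norm_smul, Real.norm_of_nonneg (by norm_num : (0 : ℝ) ≤ 1 / 2)] at h1
    have h2 := parallelogram_law_with_norm ℝ (v j) (v i)
    rw [add_comm (v j) (v i)] at h2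
    nlinarith [norm_nonneg (v i), norm_nonneg (v i + v j)]
  have hvcau : CauchySeq v := by
    refine Metric.cauchySeq_iff'.2 fun ε hε => ?_
    obtain ⟨N, hN⟩ := Metric.cauchySeq_iff'.1 hcau (ε ^ 2 / 2) (by positivity)
    refine ⟨N, fun j hj => ?_⟩
    have h1 := hN j hj
    rw [Real.dist_eq] at h1
    have h2 := (le_abs_self _).trans_lt h1
    rw [dist_eq_norm]
    refine lt_of_pow_lt_pow_left₀ 2 hε.le ?_
    linarith [hsq N j hj]
  obtain ⟨u, hu⟩ := cauchySeq_tendsto_of_complete hvcau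
  have huC : ∀ i, u ∈ C i := fun i =>
    (hcl (c i)).mem_of_tendsto hu
      (Filter.eventually_atTop.2 ⟨i, fun j hj => hCanti hj (hvC j)⟩)
  refine ⟨u, (huC 0).1, fun w hw => ?_⟩
  exact (ge_of_tendsto' hc_lim fun i => (huC i).2).trans (sInf_le ⟨w, hw, rfl⟩)

end DirectMethod

attribute [local instance] Matrix.frobeniusNormedRing Matrix.frobeniusNormedAlgebra
  Matrix.frobeniusNormedSpace

/-! ### Matrix logarithm and exponential as inverse homeomorphisms -/

section MatrixLog

/-- The matrix exponential. -/
noncomputable def matExp {m : ℕ} (A : Mat m) : Mat m := NormedSpace.exp A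

open scoped Matrix.Norms.L2Operator MatrixOrder in
theorem matExp_matLog {m} {A : Mat m} (h : A.PosDef) : matExp (matLog A) = A := CFC.exp_log A

open scoped Matrix.Norms.L2Operator MatrixOrder in
theorem matLog_matExp {m} {A : Mat m} (h : A.IsHermitian) : matLog (matExp A) = A := CFC.log_exp A h

theorem matLog_isHermitian {m} (A : Mat m) : (matLog A).IsHermitian :=
  cfc_predicate Real.log A

open scoped Matrix.Norms.L2Operator MatrixOrder in
theorem matExp_posDef {m} {A : Mat m} (h : A.IsHermitian) : (matExp A).PosDef := by
  rw [← Matrix.isStrictlyPositive_iff_posDef]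
  have : matExp A = cfc Real.exp A := (CFC.real_exp_eq_normedSpace_exp h).symm
  rw [this]
  exact (cfc_isStrictlyPositive_iff Real.exp A (by fun_prop) h).2 fun x _ => Real.exp_pos x

theorem exists_lipschitzOnWith_matExp (m : ℕ) (z : ℝ) :
    ∃ L, LipschitzOnWith L (matExp (m := m)) (Metric.closedBall 0 z) := by
  have : ProperSpace (Mat m) := FiniteDimensional.proper ℝ _
  have h : ContDiff ℝ 1 (NormedSpace.exp : Mat m → Mat m) :=
    contDiff_iff_contDiffAt.2 fun x => (NormedSpace.exp_analytic (𝕂 := ℝ) x).contDiffAt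
  exact h.contDiffOn.exists_lipschitzOnWith one_ne_zero (convex_closedBall _ _)
    (isCompact_closedBall _ _)

/-- Makes the matrices a Hilbert space under the given norm, which supplies strict convexity and the
`L²` structure. -/
theorem frobenius_parallelogram_law {m} (A B : Mat m) :
    ‖A + B‖ * ‖A + B‖ + ‖A - B‖ * ‖A - B‖ = 2 * (‖A‖ * ‖A‖ + ‖B‖ * ‖B‖) := by
  have key (C : Mat m) : ‖C‖ * ‖C‖ = ∑ i, ∑ j, (C i j) ^ 2 := by
    rw [Matrix.frobenius_norm_def, ← Real.sqrt_eq_rpow]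
    simpa using Real.mul_self_sqrt (x := ∑ i, ∑ j, (C i j) ^ 2)
      (Finset.sum_nonneg fun i _ => Finset.sum_nonneg fun j _ => sq_nonneg _)
  simp only [key, ← Finset.sum_add_distrib, Finset.mul_sum, Matrix.add_apply, Matrix.sub_apply]
  refine Finset.sum_congr rfl fun i _ => Finset.sum_congr rfl fun j _ => by ring

/-- Symmetric matrices of Frobenius norm at most `z`. -/
def symBall (m : ℕ) (z : ℝ) : Set (Mat m) := {A | A.IsHermitian ∧ ‖A‖ ≤ z}

theorem isClosed_isHermitian (m : ℕ) : IsClosed {A : Mat m | A.IsHermitian} := by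
  have hc : Continuous (fun A : Mat m => A.conjTranspose) := continuous_id.matrix_conjTranspose
  exact isClosed_eq hc continuous_id

theorem isCompact_symBall (m z) : IsCompact (symBall m z) := by
  have : ProperSpace (Mat m) := FiniteDimensional.proper ℝ _
  have h : symBall m z = Metric.closedBall 0 z ∩ {A | A.IsHermitian} := by
    ext A; simp [symBall, and_comm]
  rw [h]
  exact (isCompact_closedBall _ _).inter_right (isClosed_isHermitian m)

theorem convex_symBall (m z) : Convex ℝ (symBall m z) := by
  have h : symBall m z = Metric.closedBall 0 z ∩ {A | A.IsHermitian} := by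
    ext A; simp [symBall, and_comm]
  rw [h]
  refine (convex_closedBall _ _).inter ?_
  intro A hA B hB a b _ _ _
  change (a • A + b • B).conjTranspose = a • A + b • B
  rw [Matrix.conjTranspose_add, Matrix.conjTranspose_smul, Matrix.conjTranspose_smul,
    hA.out, hB.out, star_trivial, star_trivial]

theorem matLog_mem_symBall {m z} {A : Mat m} (h : A ∈ SPDLog m z) : matLog A ∈ symBall m z :=
  ⟨matLog_isHermitian A, h.2⟩

theorem matExp_mem_SPDLog {m z} {A : Mat m} (h : A ∈ symBall m z) : matExp A ∈ SPDLog m z :=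
  ⟨matExp_posDef h.1, by rw [matLog_matExp h.1]; exact h.2⟩

theorem continuousOn_matExp (m z) : ContinuousOn (matExp (m := m)) (symBall m z) := by
  obtain ⟨L, hL⟩ := exists_lipschitzOnWith_matExp m z
  exact hL.continuousOn.mono fun A hA => by simpa using hA.2

theorem image_matExp_symBall (m z) : matExp '' symBall m z = SPDLog m z := by
  ext A
  constructor
  · rintro ⟨B, hB, rfl⟩; exact matExp_mem_SPDLog hB
  · intro hA; exact ⟨_, matLog_mem_symBall hA, matExp_matLog hA.1⟩

theorem isCompact_SPDLog (m z) : IsCompact (SPDLog m z) := by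
  rw [← image_matExp_symBall]
  exact (isCompact_symBall m z).image_of_continuousOn (continuousOn_matExp m z)

/-- The inverse of a continuous bijection on a compact set is continuous: the preimage of a closed
set is the `matExp`-image of a compact one. -/
theorem continuousOn_matLog (m z) : ContinuousOn (matLog (m := m)) (SPDLog m z) := by
  rw [continuousOn_iff_isClosed]
  intro t ht
  refine ⟨matExp '' (symBall m z ∩ t), ?_, ?_⟩
  · exact (((isCompact_symBall m z).inter_right ht).image_of_continuousOn
      ((continuousOn_matExp m z).mono Set.inter_subset_left)).isClosed
  · ext A
    constructor
    · rintro ⟨h1, h2⟩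
      exact ⟨⟨_, ⟨matLog_mem_symBall h2, h1⟩, matExp_matLog h2.1⟩, h2⟩
    · rintro ⟨⟨B, hB, rfl⟩, h2⟩
      exact ⟨by simpa [matLog_matExp hB.1.1] using hB.2, h2⟩

end MatrixLog

theorem ENNReal.liminf_add_liminf_le {u v : ℕ → ℝ≥0∞} :
    Filter.liminf u Filter.atTop + Filter.liminf v Filter.atTop ≤
      Filter.liminf (fun j => u j + v j) Filter.atTop := by
  simp only [Filter.liminf_eq_iSup_iInf_of_nat]
  rw [ENNReal.iSup_add_iSup_of_monotone
    (fun i j hij => biInf_mono fun _ h => hij.trans h)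
    (fun i j hij => biInf_mono fun _ h => hij.trans h)]
  exact iSup_mono fun i => le_iInf₂ fun j hj => add_le_add (iInf₂_le j hj) (iInf₂_le j hj)

/-! ### Convexity and equality cases of the fidelity-plus-increment energy -/

section PairEnergy

/-- A fidelity term on `A` plus a nonlocal term with kernel `k`. -/
noncomputable def pairEnergy {X E : Type*} [MeasurableSpace X] [NormedAddCommGroup E]
    (μ : Measure X) (A : Set X) (p : ℝ) (k : X × X → ℝ≥0∞) (f u : X → E) : ℝ≥0∞ :=
  weightedEnergy (μ.restrict A) p 1 (fun x => u x - f x) +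
    weightedEnergy (μ.prod μ) p k (fun q => u q.1 - u q.2)

theorem fidelity_combo {X E : Type*} [AddCommGroup E] [Module ℝ E] {f u v : X → E}
    {a b : ℝ} (hab : a + b = 1) :
    (fun x => (a • u x + b • v x) - f x) = fun x => a • (u x - f x) + b • (v x - f x) := by
  funext x
  have h : f x = a • f x + b • f x := by rw [← add_smul, hab, one_smul]
  nth_rewrite 1 [h]
  simp only [smul_sub]
  abel

theorem increment_combo {X E : Type*} [AddCommGroup E] [Module ℝ E] {u v : X → E} {a b : ℝ} :
    (fun q : X × X => (a • u q.1 + b • v q.1) - (a • u q.2 + b • v q.2)) =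
      fun q => a • (u q.1 - u q.2) + b • (v q.1 - v q.2) := by
  funext q
  simp only [smul_sub]
  abel

variable {X E : Type*} [MeasurableSpace X] {μ : Measure X} [NormedAddCommGroup E]

theorem weightedEnergy_congr_ae {Y : Type*} [MeasurableSpace Y] {ν : Measure Y} {p : ℝ}
    {k : Y → ℝ≥0∞} {U V : Y → E} (h : U =ᵐ[ν] V) :
    weightedEnergy ν p k U = weightedEnergy ν p k V :=
  lintegral_congr_ae (h.mono fun y hy => by simp only [hy])

variable {A : Set X} {p : ℝ} {k : X × X → ℝ≥0∞} {f : X → E}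

theorem aestronglyMeasurable_increment [SFinite μ] {u : X → E} (hu : AEStronglyMeasurable u μ) :
    AEStronglyMeasurable (fun q : X × X => u q.1 - u q.2) (μ.prod μ) :=
  hu.comp_fst.sub hu.comp_snd

theorem pairEnergy_congr_ae [SFinite μ] {u v : X → E} (h : u =ᵐ[μ] v) :
    pairEnergy μ A p k f u = pairEnergy μ A p k f v := by
  refine congrArg₂ (· + ·) (weightedEnergy_congr_ae ?_) (weightedEnergy_congr_ae ?_)
  · filter_upwards [ae_restrict_of_ae h] with x hx
    rw [hx]
  · filter_upwards [Measure.quasiMeasurePreserving_fst.ae h, Measure.quasiMeasurePreserving_snd.ae h]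
      with q h1 h2
    rw [h1, h2]

variable [NormedSpace ℝ E]

theorem pairEnergy_combo_le [SFinite μ] [StrictConvexSpace ℝ E] (hp : 1 < p)
    (hk : AEMeasurable k (μ.prod μ)) (hf : AEStronglyMeasurable f μ) {u v : X → E}
    (hu : AEStronglyMeasurable u μ) (hv : AEStronglyMeasurable v μ) {a b : ℝ} (ha : 0 ≤ a)
    (hb : 0 ≤ b) (hab : a + b = 1) :
    pairEnergy μ A p k f (fun x => a • u x + b • v x) ≤
      ENNReal.ofReal a * pairEnergy μ A p k f u + ENNReal.ofReal b * pairEnergy μ A p k f v := by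
  unfold pairEnergy
  rw [fidelity_combo hab, increment_combo, mul_add, mul_add, add_add_add_comm]
  exact add_le_add
    (weightedEnergy_combo_le hp aemeasurable_const (hu.sub hf).restrict (hv.sub hf).restrict
      ha hb hab)
    (weightedEnergy_combo_le hp hk (aestronglyMeasurable_increment hu)
      (aestronglyMeasurable_increment hv) ha hb hab)

/-- Two minimizers of the energy agree on the fidelity region and have the same increments
wherever the kernel is positive. -/
theorem ae_eq_of_pairEnergy_minimal [SFinite μ] [StrictConvexSpace ℝ E] (hp : 1 < p)
    (hk : AEMeasurable k (μ.prod μ)) (hkt : ∀ q, k q ≠ ⊤) (hf : AEStronglyMeasurable f μ)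
    {u v : X → E} (hu : AEStronglyMeasurable u μ) (hv : AEStronglyMeasurable v μ)
    (hfin : pairEnergy μ A p k f u ≠ ⊤)
    (huv : pairEnergy μ A p k f v = pairEnergy μ A p k f u)
    (hmin : pairEnergy μ A p k f u ≤
      pairEnergy μ A p k f (fun x => (1 / 2 : ℝ) • u x + (1 / 2 : ℝ) • v x)) :
    (∀ᵐ x ∂(μ.restrict A), u x = v x) ∧
      ∀ᵐ q ∂(μ.prod μ), k q ≠ 0 → u q.1 - u q.2 = v q.1 - v q.2 := by
  have hhalf : (1 / 2 : ℝ) + 1 / 2 = 1 := by norm_num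
  have hpos : (0 : ℝ) < 1 / 2 := by norm_num
  have hof : ENNReal.ofReal (1 / 2) + ENNReal.ofReal (1 / 2) = 1 := by
    rw [← ENNReal.ofReal_add hpos.le hpos.le, hhalf, ENNReal.ofReal_one]
  have hu1 := (hu.sub hf).restrict (s := A)
  have hv1 := (hv.sub hf).restrict (s := A)
  have hu2 := aestronglyMeasurable_increment hu
  have hv2 := aestronglyMeasurable_increment hv
  have h1 := weightedEnergy_combo_le (k := 1) hp aemeasurable_const hu1 hv1 hpos.le hpos.le hhalf
  have h2 := weightedEnergy_combo_le hp hk hu2 hv2 hpos.le hpos.le hhalf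
  have havg : ENNReal.ofReal (1 / 2) * pairEnergy μ A p k f u +
      ENNReal.ofReal (1 / 2) * pairEnergy μ A p k f v = pairEnergy μ A p k f u := by
    rw [huv, ← add_mul, hof, one_mul]
  have hle := havg.le.trans hmin
  have hfin' : pairEnergy μ A p k f (fun x => (1 / 2 : ℝ) • u x + (1 / 2 : ℝ) • v x) ≠ ⊤ :=
    ne_top_of_le_ne_top hfin
      ((pairEnergy_combo_le hp hk hf hu hv hpos.le hpos.le hhalf).trans_eq havg)
  unfold pairEnergy at hle hfin'
  rw [fidelity_combo hhalf, increment_combo] at hle hfin'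
  rw [mul_add, mul_add, add_add_add_comm] at hle
  obtain ⟨hfin1, hfin2⟩ := ENNReal.add_ne_top.1 hfin'
  -- Each term is convex and the sum attains equality at the midpoint, so each term does too;
  -- finiteness permits the cancellation.
  have hle1 := (ENNReal.add_le_add_iff_right hfin2).1 ((add_le_add_right h2 _).trans hle)
  have hle2 := (ENNReal.add_le_add_iff_left hfin1).1 ((add_le_add_left h1 _).trans hle)
  refine ⟨?_, ae_eq_of_weightedEnergy_combo_ge hp hk hkt hu2 hv2 hpos hpos hhalf hfin2 hle2⟩
  filter_upwards [ae_eq_of_weightedEnergy_combo_ge hp aemeasurable_const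
    (fun _ => ENNReal.one_ne_top) hu1 hv1 hpos hpos hhalf hfin1 hle1] with x hx
  exact sub_left_inj.1 (hx one_ne_zero)

end PairEnergy

/-! ### Existence of minimizers by the direct method in `L²` -/

section Existence

variable {X E : Type*} [MeasurableSpace X] {μ : Measure X} [IsFiniteMeasure μ]
  [NormedAddCommGroup E]
  {A : Set X} {p : ℝ} {k : X × X → ℝ≥0∞} {f : X → E} {K : Set E}

theorem isClosed_pairEnergy_sublevel (hk : AEMeasurable k (μ.prod μ))
    (hkt : ∀ q, k q ≠ ⊤) (hf : AEStronglyMeasurable f μ) (hK : IsClosed K) (c : ℝ≥0∞) :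
    IsClosed {u : Lp E 2 μ | (∀ᵐ x ∂μ, u x ∈ K) ∧ pairEnergy μ A p k f u ≤ c} := by
  refine IsSeqClosed.isClosed fun u v hu huv => ?_
  -- An a.e. convergent subsequence is enough, since the energy bound `c` holds along the whole
  -- sequence.
  obtain ⟨ns, -, hns⟩ := (tendstoInMeasure_of_tendsto_Lp huv).exists_seq_tendsto_ae
  refine ⟨?_, ?_⟩
  · filter_upwards [hns, ae_all_iff.2 fun j => (hu (ns j)).1] with x hx hxK
    exact hK.mem_of_tendsto hx (Filter.Eventually.of_forall hxK)
  · have hm : ∀ j, AEStronglyMeasurable (u (ns j)) μ := fun j => Lp.aestronglyMeasurable _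
    have h1 : weightedEnergy (μ.restrict A) p 1 (fun x => v x - f x) ≤ _ :=
      weightedEnergy_le_liminf (U := fun j x => u (ns j) x - f x) aemeasurable_const
      (fun _ => ENNReal.one_ne_top) (fun j => ((hm j).sub hf).restrict)
      (ae_restrict_of_ae (hns.mono fun x hx => hx.sub_const _))
    have h2 : weightedEnergy (μ.prod μ) p k (fun q => v q.1 - v q.2) ≤ _ :=
      weightedEnergy_le_liminf (U := fun j q => u (ns j) q.1 - u (ns j) q.2) hk hkt
      (fun j => aestronglyMeasurable_increment (hm j)) (by
        filter_upwards [Measure.quasiMeasurePreserving_fst.ae hns,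
          Measure.quasiMeasurePreserving_snd.ae hns] with q h1 h2
        exact h1.sub h2)
    calc pairEnergy μ A p k f v ≤ _ := add_le_add h1 h2
      _ ≤ Filter.liminf (fun j => pairEnergy μ A p k f (u (ns j))) Filter.atTop :=
          ENNReal.liminf_add_liminf_le
            (u := fun j => weightedEnergy (μ.restrict A) p 1 (fun x => u (ns j) x - f x))
            (v := fun j => weightedEnergy (μ.prod μ) p k (fun q => u (ns j) q.1 - u (ns j) q.2))
      _ ≤ c := by
          refine (Filter.liminf_le_liminf (Filter.Eventually.of_forall fun j => (hu (ns j)).2)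
            ).trans_eq ?_
          exact Filter.liminf_const c

variable [InnerProductSpace ℝ E]

theorem convex_pairEnergy_sublevel (hp : 1 < p) (hk : AEMeasurable k (μ.prod μ))
    (hf : AEStronglyMeasurable f μ) (hK : Convex ℝ K) (c : ℝ≥0∞) :
    Convex ℝ {u : Lp E 2 μ | (∀ᵐ x ∂μ, u x ∈ K) ∧ pairEnergy μ A p k f u ≤ c} := by
  intro u hu v hv a b ha hb hab
  have hcoe : (a • u + b • v : Lp E 2 μ) =ᵐ[μ] fun x => a • u x + b • v x := by
    filter_upwards [Lp.coeFn_add (a • u) (b • v), Lp.coeFn_smul a u, Lp.coeFn_smul b v]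
      with x h1 h2 h3
    rw [h1, Pi.add_apply, h2, h3, Pi.smul_apply, Pi.smul_apply]
  refine ⟨?_, ?_⟩
  · filter_upwards [hcoe, hu.1, hv.1] with x hx h1 h2
    rw [hx]
    exact hK h1 h2 ha hb hab
  · rw [pairEnergy_congr_ae hcoe]
    refine (pairEnergy_combo_le hp hk hf (Lp.aestronglyMeasurable u) (Lp.aestronglyMeasurable v)
      ha hb hab).trans ?_
    calc _ ≤ ENNReal.ofReal a * c + ENNReal.ofReal b * c := by
          gcongr
          exacts [hu.2, hv.2]
      _ = c := by
          rw [← add_mul, ← ENNReal.ofReal_add ha hb, hab, ENNReal.ofReal_one, one_mul]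

/-- The energy attains its minimum among the measurable functions with values in a closed bounded
convex set. -/
theorem exists_pairEnergy_minimal [CompleteSpace E] (hp : 1 < p) (hk : AEMeasurable k (μ.prod μ))
    (hkt : ∀ q, k q ≠ ⊤) (hf : AEStronglyMeasurable f μ) (hKne : K.Nonempty)
    (hKcl : IsClosed K) (hKconv : Convex ℝ K) (hKb : Bornology.IsBounded K) :
    ∃ u : X → E, AEStronglyMeasurable u μ ∧ (∀ᵐ x ∂μ, u x ∈ K) ∧
      ∀ v : X → E, AEStronglyMeasurable v μ → (∀ᵐ x ∂μ, v x ∈ K) →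
        pairEnergy μ A p k f u ≤ pairEnergy μ A p k f v := by
  obtain ⟨R, hR⟩ := hKb.exists_norm_le
  -- Bounded values and finite measure allow working in `L²` whatever `p` is.
  have hmem : ∀ v : X → E, AEStronglyMeasurable v μ → (∀ᵐ x ∂μ, v x ∈ K) → MemLp v 2 μ :=
    fun v hv hvK => MemLp.of_bound hv R (hvK.mono fun x hx => hR _ hx)
  have hlift : ∀ v (hv : AEStronglyMeasurable v μ) (hvK : ∀ᵐ x ∂μ, v x ∈ K),
      ∀ᵐ x ∂μ, (hmem v hv hvK).toLp v x ∈ K := fun v hv hvK => by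
    filter_upwards [(hmem v hv hvK).coeFn_toLp, hvK] with x hx hxK
    rwa [hx]
  obtain ⟨y, hy⟩ := hKne
  have hyK : ∀ᵐ x : X ∂μ, (fun _ => y) x ∈ K := Filter.Eventually.of_forall fun _ => hy
  obtain ⟨u, huS, humin⟩ := exists_isMinOn_of_isClosed_convex_sublevel
    (S := {u : Lp E 2 μ | ∀ᵐ x ∂μ, u x ∈ K}) (G := fun u => pairEnergy μ A p k f u)
    ⟨_, hlift _ aestronglyMeasurable_const hyK⟩
    (isBounded_iff_forall_norm_le.2 ⟨_, fun u hu =>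
      Lp.norm_le_of_ae_bound (C := max R 0) (le_max_right _ _)
        (Filter.Eventually.mono (p := fun x => u x ∈ K) hu
          fun x hx => (hR _ hx).trans (le_max_left _ _))⟩)
    (convex_pairEnergy_sublevel hp hk hf hKconv)
    (isClosed_pairEnergy_sublevel hk hkt hf hKcl)
  refine ⟨u, Lp.aestronglyMeasurable u, huS, fun v hv hvK => ?_⟩
  rw [← pairEnergy_congr_ae (hmem v hv hvK).coeFn_toLp]
  exact humin (hlift v hv hvK)

end Existence

/-! ### Propagation of zeros through a connected open set -/

section Connected

/-- A function on a connected open set whose values agree almost everywhere at distance less than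
`η`, and which vanishes on a set of positive measure, vanishes almost everywhere. -/
theorem ae_eq_zero_of_locally_const {X E : Type*} [PseudoMetricSpace X]
    [SecondCountableTopology X] [MeasurableSpace X] [OpensMeasurableSpace X] {μ : Measure X}
    [SFinite μ] [μ.IsOpenPosMeasure] [Zero E] {Ω B : Set X} (hΩo : IsOpen Ω)
    (hΩc : IsPreconnected Ω) (hBΩ : B ⊆ Ω) (hBm : MeasurableSet B) (hB : μ B ≠ 0)
    {h : X → E} {η : ℝ} (hη : 0 < η)
    (hBh : ∀ᵐ x ∂(μ.restrict B), h x = 0)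
    (hloc : ∀ᵐ q ∂((μ.restrict Ω).prod (μ.restrict Ω)), dist q.1 q.2 < η → h q.1 = h q.2) :
    ∀ᵐ x ∂(μ.restrict Ω), h x = 0 := by
  have hae := Measure.ae_ae_of_ae_prod hloc
  -- Any two points of a ball of radius `η / 2` are closer than `η`, so one base point that is
  -- generic in the sense of Fubini fixes the value `c`.
  have hball : ∀ x ∈ Ω, ∃ c : E, ∀ᵐ y ∂μ, y ∈ Metric.ball x (η / 2) ∩ Ω → h y = c := by
    intro x hx
    have hpos : μ (Metric.ball x (η / 2) ∩ Ω) ≠ 0 :=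
      ((Metric.isOpen_ball.inter hΩo).measure_pos μ
        ⟨x, Metric.mem_ball_self (by positivity), hx⟩).ne'
    rw [ae_restrict_iff' hΩo.measurableSet] at hae
    obtain ⟨x₀, hx₀, hx₀'⟩ : ∃ x₀ ∈ Metric.ball x (η / 2) ∩ Ω,
        ∀ᵐ y ∂(μ.restrict Ω), dist x₀ y < η → h x₀ = h y := by
      by_contra hcon
      refine hpos (measure_mono_null ?_ hae)
      intro y hy hy'
      exact hcon ⟨y, hy, hy' hy.2⟩
    refine ⟨h x₀, ?_⟩
    rw [ae_restrict_iff' hΩo.measurableSet] at hx₀'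
    filter_upwards [hx₀'] with y hy hyb
    refine (hy hyb.2 ?_).symm
    have h1 := Metric.mem_ball.1 hx₀.1
    have h2 := Metric.mem_ball'.1 hyb.1
    linarith [dist_triangle x₀ x y]
  -- `U` is open, meets `Ω`, and is relatively closed in it, hence contains `Ω`.
  set U : Set X := {x | ∃ r > 0, ∀ᵐ y ∂μ, y ∈ Metric.ball x r ∩ Ω → h y = 0} with hU
  have hUo : IsOpen U := by
    refine Metric.isOpen_iff.2 ?_
    rintro x ⟨r, hr, hx⟩
    refine ⟨r / 2, by positivity, fun y hy => ⟨r / 2, by positivity, ?_⟩⟩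
    filter_upwards [hx] with w hw hwy
    refine hw ⟨?_, hwy.2⟩
    have h1 := Metric.mem_ball.1 hwy.1
    have h2 := Metric.mem_ball.1 hy
    exact Metric.mem_ball.2 (by linarith [dist_triangle w y x])
  have hspread : ∀ x ∈ Ω, ∀ T ⊆ Metric.ball x (η / 2) ∩ Ω, μ T ≠ 0 →
      (∀ᵐ y ∂μ, y ∈ T → h y = 0) → x ∈ U := by
    intro x hx T hT hTpos hT0
    obtain ⟨c, hc⟩ := hball x hx
    have hc0 : c = 0 := by
      by_contra hne
      refine hTpos (measure_mono_null ?_ (hc.and hT0))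
      rintro y hy ⟨h1, h2⟩
      exact hne ((h1 (hT hy)).symm.trans (h2 hy))
    exact ⟨η / 2, by positivity, hc0 ▸ hc⟩
  have hUne : (Ω ∩ U).Nonempty := by
    obtain ⟨x, hxB, hx⟩ := exists_mem_forall_mem_nhdsWithin_pos_measure hB
    refine ⟨x, hBΩ hxB, hspread x (hBΩ hxB) (Metric.ball x (η / 2) ∩ B)
      (Set.inter_subset_inter_right _ hBΩ)
      (hx _ (Filter.inter_mem (mem_nhdsWithin_of_mem_nhds (Metric.ball_mem_nhds x (by positivity)))
        self_mem_nhdsWithin)).ne' ?_⟩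
    filter_upwards [(ae_restrict_iff' hBm).1 hBh] with y hy hyB using hy hyB.2
  have hUcl : closure U ∩ Ω ⊆ U := by
    rintro x ⟨hxU, hx⟩
    obtain ⟨y, hyU, hy⟩ : ((Metric.ball x (η / 2) ∩ Ω) ∩ U).Nonempty :=
      mem_closure_iff.1 hxU _ (Metric.isOpen_ball.inter hΩo)
        ⟨Metric.mem_ball_self (by positivity), hx⟩
    obtain ⟨r, hr, hyr⟩ := hy
    refine hspread x hx (Metric.ball y r ∩ (Metric.ball x (η / 2) ∩ Ω)) Set.inter_subset_right
      ((Metric.isOpen_ball.inter (Metric.isOpen_ball.inter hΩo)).measure_pos μ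
        ⟨y, Metric.mem_ball_self hr, hyU⟩).ne' ?_
    filter_upwards [hyr] with w hw hwT
    exact hw ⟨hwT.1, hwT.2.2⟩
  have hΩU : Ω ⊆ U := hΩc.subset_of_closure_inter_subset hUo hUne hUcl
  rw [ae_restrict_iff' hΩo.measurableSet, ae_iff]
  refine measure_null_of_locally_null _ fun x hx => ?_
  have hxΩ : x ∈ Ω := (Classical.not_imp.1 hx).1
  obtain ⟨r, hr, hxr⟩ := hΩU hxΩ
  refine ⟨_, inter_mem_nhdsWithin _ (Metric.ball_mem_nhds x hr), measure_mono_null ?_ hxr⟩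
  rintro y ⟨hy, hyr⟩ hcon
  obtain ⟨h1, h2⟩ := Classical.not_imp.1 hy
  exact h2 (hcon ⟨hyr, h1⟩)

end Connected

/-- Extending `g` by a constant off the closed set gives a Borel map, which agrees with `g` at
almost every value of `u`. -/
theorem ContinuousOn.comp_aestronglyMeasurable_of_isClosed {X E F : Type*} [MeasurableSpace X]
    {μ : Measure X} [PseudoMetricSpace E] [PseudoMetricSpace F] [SecondCountableTopology F]
    {s : Set E} {g : E → F} (hg : ContinuousOn g s) (hs : IsClosed s)
    {u : X → E} (hu : AEStronglyMeasurable u μ) (hus : ∀ᵐ x ∂μ, u x ∈ s) :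
    AEStronglyMeasurable (fun x => g (u x)) μ := by
  classical
  rcases isEmpty_or_nonempty X with hX | ⟨⟨x₀⟩⟩
  · exact (StronglyMeasurable.of_discrete).aestronglyMeasurable
  borelize E
  borelize F
  have hm : Measurable (s.piecewise g fun _ => g (u x₀)) :=
    hg.measurable_piecewise continuousOn_const hs.measurableSet
  refine (hm.comp_aemeasurable hu.aemeasurable).aestronglyMeasurable.congr ?_
  filter_upwards [hus] with x hx
  simp [Set.piecewise_eq_of_mem _ _ _ hx]

/-! ### The concrete kernel and recovery of Sobolev regularity -/

section Kernel

/-- The interaction kernel of the regularizer, including the regularization parameter. -/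
noncomputable def regKernel {n : ℕ} (s p α : ℝ) (ρ : Rn n → ℝ) (l : ℕ) (q : Rn n × Rn n) : ℝ≥0∞ :=
  ENNReal.ofReal (α * (ρ (q.1 - q.2) ^ l / ‖q.1 - q.2‖ ^ ((n : ℝ) + p * s)))

variable {n m : ℕ} {Ω D : Set (Rn n)} {s p α : ℝ} {ρ : Rn n → ℝ} {l : ℕ}

theorem measurable_regKernel (hρ : Continuous ρ) : Measurable (regKernel s p α ρ l) := by
  have h1 : Measurable fun q : Rn n × Rn n => ρ (q.1 - q.2) :=
    (hρ.comp (continuous_fst.sub continuous_snd)).measurable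
  have h2 : Measurable fun q : Rn n × Rn n => ‖q.1 - q.2‖ :=
    (continuous_fst.sub continuous_snd).norm.measurable
  exact (((h1.pow_const l).div (h2.pow_const _)).const_mul α).ennreal_ofReal

theorem enorm_rpow_mul_regKernel {E : Type*} [NormedAddCommGroup E] (hp : 0 ≤ p) (x : E)
    (q : Rn n × Rn n) :
    ‖x‖ₑ ^ p * regKernel s p α ρ l q = ENNReal.ofReal
      (‖x‖ ^ p * (α * (ρ (q.1 - q.2) ^ l / ‖q.1 - q.2‖ ^ ((n : ℝ) + p * s)))) := by
  rw [enorm_rpow_eq_ofReal _ hp, regKernel, ← ENNReal.ofReal_mul (by positivity)]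

/-- In logarithmic coordinates the functional is a convex energy. -/
theorem functionalF_eq_pairEnergy (hΩD : MeasurableSet (Ω \ D)) (hp : 0 ≤ p) (hα : 0 ≤ α)
    (v w : Rn n → Mat m) :
    functionalF Ω D s p α ρ l v w = pairEnergy (volume.restrict Ω) (Ω \ D) p
      (regKernel s p α ρ l) (fun x => matLog (v x)) (fun x => matLog (w x)) := by
  unfold functionalF pairEnergy regularizer weightedEnergy
  rw [lintegral_indicator hΩD, ← lintegral_const_mul' _ _ ENNReal.ofReal_ne_top]
  congr 1
  · refine lintegral_congr fun x => ?_
    rw [Pi.one_apply, mul_one, enorm_rpow_eq_ofReal _ hp, logDist]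
  · refine lintegral_congr fun q => ?_
    rw [enorm_rpow_mul_regKernel hp, ← ENNReal.ofReal_mul hα, logDist]
    congr 1
    ring

/-- Treats both values of `l` at once: for `l = 0` the weight is `1` and any radius works, for `l =
1` the superlevel ball serves. -/
theorem IsMollifier.exists_le_pow (hρ : IsMollifier ρ) (hl : l = 0 ∨ l = 1) :
    ∃ τ > 0, ∃ η > 0, ∀ x, ‖x‖ ≤ η → τ ≤ ρ x ^ l := by
  rcases hl with rfl | rfl
  · exact ⟨1, one_pos, 1, one_pos, fun x _ => by simp⟩
  · obtain ⟨τ, hτ, -, η, hη, hset⟩ := hρ.superlevel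
    refine ⟨τ, hτ, η, hη, fun x hx => ?_⟩
    have : x ∈ {x | τ ≤ ρ x} := hset ▸ mem_closedBall_zero_iff.2 hx
    rw [pow_one]
    exact this

/-- A bounded function of finite nonlocal energy, composed with the matrix exponential, has finite
Gagliardo seminorm. -/
theorem memLp_gagliardo {z : ℝ} (hp : 0 < p) (hs : 0 < s) (hα : 0 < α)
    [IsFiniteMeasure (volume.restrict Ω)] {τ η : ℝ} (hτ : 0 < τ) (hη : 0 < η)
    (hρ0 : ∀ x, 0 ≤ ρ x)
    (hρ : ∀ x, ‖x‖ ≤ η → τ ≤ ρ x ^ l) {u w : Rn n → Mat m}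
    (hw : AEStronglyMeasurable w (volume.restrict Ω))
    (hwu : ∀ᵐ x ∂(volume.restrict Ω), w x = matExp (u x))
    (hu : ∀ᵐ x ∂(volume.restrict Ω), u x ∈ symBall m z)
    (hfin : weightedEnergy ((volume.restrict Ω).prod (volume.restrict Ω)) p
      (regKernel s p α ρ l) (fun q => u q.1 - u q.2) ≠ ⊤) :
    MemLp (fun q : Rn n × Rn n => ‖w q.1 - w q.2‖ / ‖q.1 - q.2‖ ^ ((n : ℝ) / p + s))
      (ENNReal.ofReal p) ((volume.restrict Ω).prod (volume.restrict Ω)) := by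
  obtain ⟨L, hL⟩ := exists_lipschitzOnWith_matExp m z
  set a : ℝ := (n : ℝ) + p * s with ha
  have ha0 : 0 < a := by positivity
  have hmeas : AEStronglyMeasurable
      (fun q : Rn n × Rn n => ‖w q.1 - w q.2‖ / ‖q.1 - q.2‖ ^ ((n : ℝ) / p + s))
      ((volume.restrict Ω).prod (volume.restrict Ω)) := by
    have h2 : Measurable fun q : Rn n × Rn n => ‖q.1 - q.2‖ :=
      (continuous_fst.sub continuous_snd).norm.measurable
    exact ((aestronglyMeasurable_increment hw).norm.aemeasurable.div
      (h2.pow_const _).aemeasurable).aestronglyMeasurable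
  refine ⟨hmeas, ?_⟩
  rw [eLpNorm_lt_top_iff_lintegral_rpow_enorm_lt_top (by simpa using hp) ENNReal.ofReal_ne_top,
    ENNReal.toReal_ofReal hp.le]
  -- Bounds the integrand at distances above `η`, where increments of `u` are at most `2 * z`; at
  -- smaller distances the kernel is at least `α * τ / ‖q.1 - q.2‖ ^ a`.
  set M : ℝ := (L * (2 * z)) ^ p / η ^ a with hM
  have hbound : ∀ᵐ q ∂((volume.restrict Ω).prod (volume.restrict Ω)),
      ‖‖w q.1 - w q.2‖ / ‖q.1 - q.2‖ ^ ((n : ℝ) / p + s)‖ₑ ^ p ≤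
        ENNReal.ofReal (L ^ p / (α * τ)) * (‖u q.1 - u q.2‖ₑ ^ p * regKernel s p α ρ l q) +
          ENNReal.ofReal M := by
    filter_upwards [Measure.quasiMeasurePreserving_fst.ae hwu,
      Measure.quasiMeasurePreserving_snd.ae hwu, Measure.quasiMeasurePreserving_fst.ae hu,
      Measure.quasiMeasurePreserving_snd.ae hu] with q hw1 hw2 hu1 hu2
    have hz : 0 ≤ z := (norm_nonneg _).trans hu1.2
    have hlip : ‖w q.1 - w q.2‖ ≤ L * ‖u q.1 - u q.2‖ := by
      rw [hw1, hw2, ← dist_eq_norm, ← dist_eq_norm]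
      exact hL.dist_le_mul _ (mem_closedBall_zero_iff.2 hu1.2) _
        (mem_closedBall_zero_iff.2 hu2.2)
    have hdiam : ‖u q.1 - u q.2‖ ≤ 2 * z :=
      (norm_sub_le _ _).trans (by linarith [hu1.2, hu2.2])
    have hM0 : 0 ≤ M := by positivity
    have hk0 : 0 ≤ α * (ρ (q.1 - q.2) ^ l / ‖q.1 - q.2‖ ^ a) := by
      have := hρ0 (q.1 - q.2)
      positivity
    rw [enorm_rpow_mul_regKernel hp.le, enorm_rpow_eq_ofReal _ hp.le,
      ← ENNReal.ofReal_mul (by positivity),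
      ← ENNReal.ofReal_add (by positivity) hM0]
    refine ENNReal.ofReal_le_ofReal ?_
    rw [Real.norm_of_nonneg (by positivity), Real.div_rpow (norm_nonneg _) (by positivity),
      ← Real.rpow_mul (norm_nonneg _)]
    have hexp : ((n : ℝ) / p + s) * p = a := by
      rw [ha]; field_simp
    rw [hexp]
    have hpow : ‖w q.1 - w q.2‖ ^ p ≤ L ^ p * ‖u q.1 - u q.2‖ ^ p := by
      rw [← Real.mul_rpow (by positivity) (by positivity)]
      exact Real.rpow_le_rpow (norm_nonneg _) hlip hp.le
    rcases le_or_gt ‖q.1 - q.2‖ η with hq | hq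
    · have hτρ := hρ _ hq
      calc ‖w q.1 - w q.2‖ ^ p / ‖q.1 - q.2‖ ^ a
          ≤ (L ^ p * ‖u q.1 - u q.2‖ ^ p) / ‖q.1 - q.2‖ ^ a := by gcongr
        _ = L ^ p / (α * τ) * (‖u q.1 - u q.2‖ ^ p * (α * (τ / ‖q.1 - q.2‖ ^ a))) := by
            field_simp
        _ ≤ L ^ p / (α * τ) *
            (‖u q.1 - u q.2‖ ^ p * (α * (ρ (q.1 - q.2) ^ l / ‖q.1 - q.2‖ ^ a))) := by gcongr
        _ ≤ _ := le_add_of_nonneg_right hM0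
    · calc ‖w q.1 - w q.2‖ ^ p / ‖q.1 - q.2‖ ^ a ≤ (L * (2 * z)) ^ p / η ^ a := by
            have : ‖w q.1 - w q.2‖ ≤ L * (2 * z) := hlip.trans (by gcongr)
            gcongr
        _ ≤ _ := le_add_of_nonneg_left (by positivity)
  refine (lintegral_mono_ae hbound).trans_lt ?_
  rw [lintegral_add_right _ measurable_const, lintegral_const_mul' _ _ ENNReal.ofReal_ne_top,
    lintegral_const]
  exact ENNReal.add_lt_top.2 ⟨ENNReal.mul_lt_top ENNReal.ofReal_lt_top hfin.lt_top,
    ENNReal.mul_lt_top ENNReal.ofReal_lt_top (measure_lt_top _ _)⟩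

/-- The constant competitor has no increments, so the minimal energy is finite; both the Sobolev
bound and uniqueness depend on this. -/
theorem pairEnergy_zero_ne_top {X E : Type*} [MeasurableSpace X] {μ : Measure X}
    [IsFiniteMeasure μ] [NormedAddCommGroup E] {A : Set X} {k : X × X → ℝ≥0∞} {f : X → E} {z : ℝ}
    (hp : 0 < p) (hf : ∀ᵐ x ∂μ, ‖f x‖ ≤ z) : pairEnergy μ A p k f (fun _ => 0) ≠ ⊤ := by
  have h0 : weightedEnergy (μ.prod μ) p k (fun _ => (0 : E) - 0) = 0 := by
    simp [weightedEnergy, ENNReal.zero_rpow_of_pos hp]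
  unfold pairEnergy
  rw [h0, add_zero]
  refine ne_top_of_le_ne_top (b := ∫⁻ _ in A, ENNReal.ofReal (z ^ p) ∂μ) ?_
    (lintegral_mono_ae ?_)
  · rw [lintegral_const]
    exact ENNReal.mul_ne_top ENNReal.ofReal_ne_top (measure_ne_top _ _)
  · filter_upwards [ae_restrict_of_ae hf] with x hx
    rw [Pi.one_apply, mul_one, enorm_rpow_eq_ofReal _ hp.le, zero_sub, norm_neg]
    exact ENNReal.ofReal_le_ofReal (Real.rpow_le_rpow (norm_nonneg _) hx hp.le)

end Kernel

/-! ### Transfer back to positive definite matrices -/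

theorem aestronglyMeasurable_matLog {X : Type*} [MeasurableSpace X] {μ : Measure X} {m : ℕ} {z : ℝ}
    {w : X → Mat m} (hw : AEStronglyMeasurable w μ) (hwK : ∀ᵐ x ∂μ, w x ∈ SPDLog m z) :
    AEStronglyMeasurable (fun x => matLog (w x)) μ := by
  have : ProperSpace (Mat m) := FiniteDimensional.proper ℝ _
  exact (continuousOn_matLog m z).comp_aestronglyMeasurable_of_isClosed
    (isCompact_SPDLog m z).isClosed hw hwK

/-- The inner product space structure of the Frobenius norm. -/
@[reducible] noncomputable def matInnerProductSpace (m : ℕ) : InnerProductSpace ℝ (Mat m) :=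
  InnerProductSpace.ofNorm ℝ frobenius_parallelogram_law

theorem mainTheorem1 (n m : ℕ) (hn : 0 < n)
    (Ω D : Set (Rn n)) (hΩ_ne : Ω.Nonempty) (hΩ_bdd : Bornology.IsBounded Ω)
    (hΩ_conn : IsConnected Ω) (hΩ_open : IsOpen Ω) (hΩ_lip : HasLipschitzBoundary Ω)
    (hD_sub : D ⊆ Ω) (hD_meas : MeasurableSet D) (hD_vol : volume (Ω \ D) ≠ 0)
    (p s α z : ℝ) (hp : 1 < p) (hs : s ∈ Set.Ioo (0 : ℝ) 1) (hα : 0 < α) (hz : 0 ≤ z)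
    (l : ℕ) (hl : l = 0 ∨ l = 1) (ρ : Rn n → ℝ) (hρ : IsMollifier ρ)
    (wδ : LpMat m Ω p) (hwδ : wδ ∈ lebesgueSet Ω p (SPDLog m z)) :
    ∃! w : LpMat m Ω p, w ∈ fracSobolevSet Ω s p (SPDLog m z) ∧
      IsMinOn (fun u : LpMat m Ω p => functionalF Ω D s p α ρ l wδ u)
        (fracSobolevSet Ω s p (SPDLog m z)) w := by
  let _ := matInnerProductSpace m
  have : ProperSpace (Mat m) := FiniteDimensional.proper ℝ _
  have : IsFiniteMeasure (volume.restrict Ω) :=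
    ⟨by rw [Measure.restrict_apply_univ]; exact hΩ_bdd.measure_lt_top⟩
  have hp0 : 0 < p := by linarith
  have hΩD : MeasurableSet (Ω \ D) := hΩ_open.measurableSet.diff hD_meas
  obtain ⟨τ, hτ, η, hη, hρτ⟩ := hρ.exists_le_pow hl
  set μ := volume.restrict Ω with hμ
  set k := regKernel s p α ρ l with hk_def
  have hk : AEMeasurable k (μ.prod μ) :=
    (measurable_regKernel hρ.contDiff.continuous).aemeasurable
  have hkt : ∀ q, k q ≠ ⊤ := fun q => ENNReal.ofReal_ne_top
  set f : Rn n → Mat m := fun x => matLog (wδ x) with hf_def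
  have hf : AEStronglyMeasurable f μ :=
    aestronglyMeasurable_matLog (Lp.aestronglyMeasurable wδ) hwδ
  have h0K : (0 : Mat m) ∈ symBall m z := ⟨Matrix.isHermitian_zero, by simpa using hz⟩
  obtain ⟨u, hu, huK, humin⟩ := exists_pairEnergy_minimal (A := Ω \ D) hp hk hkt hf ⟨0, h0K⟩
    (isCompact_symBall m z).isClosed (convex_symBall m z) (isCompact_symBall m z).isBounded
  have hfin : pairEnergy μ (Ω \ D) p k f u ≠ ⊤ :=
    ne_top_of_le_ne_top
      (pairEnergy_zero_ne_top (z := z) hp0 (Filter.Eventually.mono hwδ fun x hx => hx.2))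
      (humin _ aestronglyMeasurable_const (Filter.Eventually.of_forall fun _ => h0K))
  have hFeq : ∀ w : LpMat m Ω p, functionalF Ω D s p α ρ l wδ w =
      pairEnergy μ (Ω \ D) p k f (fun x => matLog (w x)) := fun w =>
    functionalF_eq_pairEnergy hΩD hp0.le hα.le _ _
  obtain ⟨R, hR⟩ := (isCompact_SPDLog m z).isBounded.exists_norm_le
  have hexp : MemLp (fun x => matExp (u x)) (ENNReal.ofReal p) μ :=
    MemLp.of_bound ((continuousOn_matExp m z).comp_aestronglyMeasurable_of_isClosed
      (isCompact_symBall m z).isClosed hu huK) R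
      (huK.mono fun x hx => hR _ (matExp_mem_SPDLog hx))
  set W : LpMat m Ω p := hexp.toLp _ with hW
  have hWu : ∀ᵐ x ∂μ, W x = matExp (u x) := hexp.coeFn_toLp
  have hWK : ∀ᵐ x ∂μ, W x ∈ SPDLog m z := by
    filter_upwards [hWu, huK] with x hx hxK
    rw [hx]
    exact matExp_mem_SPDLog hxK
  have hlogW : (fun x => matLog (W x)) =ᵐ[μ] u := by
    filter_upwards [hWu, huK] with x hx hxK
    rw [hx, matLog_matExp hxK.1]
  have hFW : functionalF Ω D s p α ρ l wδ W = pairEnergy μ (Ω \ D) p k f u := by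
    rw [hFeq, pairEnergy_congr_ae hlogW]
  have hWmem : W ∈ fracSobolevSet Ω s p (SPDLog m z) :=
    ⟨memLp_gagliardo hp0 hs.1 hα hτ hη hρ.nonneg hρτ (Lp.aestronglyMeasurable W) hWu huK
      (ENNReal.add_ne_top.1 hfin).2, hWK⟩
  have hlog : ∀ w ∈ fracSobolevSet Ω s p (SPDLog m z),
      AEStronglyMeasurable (fun x => matLog (w x)) μ ∧ ∀ᵐ x ∂μ, matLog (w x) ∈ symBall m z :=
    fun w hw => ⟨aestronglyMeasurable_matLog (Lp.aestronglyMeasurable w) hw.2,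
      hw.2.mono fun x hx => matLog_mem_symBall hx⟩
  refine ⟨W, ⟨hWmem, fun w hw => ?_⟩, ?_⟩
  · change functionalF Ω D s p α ρ l wδ W ≤ functionalF Ω D s p α ρ l wδ w
    rw [hFW, hFeq w]
    exact humin _ (hlog w hw).1 (hlog w hw).2
  · rintro w ⟨hw, hwmin⟩
    obtain ⟨hv, hvK⟩ := hlog w hw
    set v : Rn n → Mat m := fun x => matLog (w x) with hv_def
    have hEq : pairEnergy μ (Ω \ D) p k f v = pairEnergy μ (Ω \ D) p k f u := by
      refine le_antisymm ?_ (humin v hv hvK)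
      rw [← hFW, ← hFeq w]
      exact hwmin hWmem
    obtain ⟨h1, h2⟩ := ae_eq_of_pairEnergy_minimal hp hk hkt hf hu hv hfin hEq
      (humin _ ((hu.const_smul _).add (hv.const_smul _)) (by
        filter_upwards [huK, hvK] with x hx hy
        exact convex_symBall m z hx hy (by norm_num) (by norm_num) (by norm_num)))
    have hzero : ∀ᵐ x ∂μ, u x - v x = 0 := by
      refine ae_eq_zero_of_locally_const hΩ_open hΩ_conn.isPreconnected Set.sdiff_subset hΩD hD_vol
        hη ?_ ?_
      · rw [hμ, Measure.restrict_restrict hΩD, Set.inter_eq_left.2 Set.sdiff_subset] at h1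
        filter_upwards [h1] with x hx
        rw [hx, sub_self]
      · filter_upwards [h2] with q hq hqη
        -- On the diagonal the kernel is `0` by the convention for division by zero, but there the
        -- claim is trivial.
        rcases eq_or_ne q.1 q.2 with h | h
        · rw [h]
        · rw [dist_eq_norm] at hqη
          have hpos : 0 < ‖q.1 - q.2‖ := norm_pos_iff.2 (sub_ne_zero.2 h)
          have hρpos : 0 < ρ (q.1 - q.2) ^ l := hτ.trans_le (hρτ _ hqη.le)
          have := hq (ENNReal.ofReal_pos.2 (by positivity)).ne'
          rw [sub_eq_sub_iff_sub_eq_sub]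
          exact this
    refine Lp.ext ?_
    filter_upwards [hWu, hzero, hw.2] with x hx h0 hwx
    rw [hx, sub_eq_zero.1 h0, hv_def, matExp_matLog hwx.1]
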